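/- Let $A$ be a unital, separable, simple, infinite-dimensional C$^*$-algebra with at least one tracial state. Let $T(A)$ be the set of tracial states of $A$, with the weak-$*$ topology, let $\partial_e(T(A))$ be the set of extreme points of $T(A)$ with the relative topology, and suppose that $\partial_e(T(A))$ is compact. Then for every continuous function $f : \partial_e(T(A)) \to [0,\infty)$ there is a sequence $(a_n)_{n\in\mathbb N}$ of positive elements of $A$ such that $$\lim_{n\to\infty}\ \max_{\tau\in\partial_e(T(A))} |\tau(a_n)-f(\tau)| = 0 \qquad\text{and}\qquad \|a_n\|\le \|f\| \text{ for all } n\in\mathbb N,$$ where $\|f\| = \max_{\tau\in\partial_e(T(A))} |f(\tau)|$. -/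

import Mathlib

open Filter Topology
open scoped ComplexOrder

/-- The trace space `T(A)` of a unital C*-algebra: the set of tracial states of `A`, inside the
dual of `A` with the weak-* topology. -/
def traceSpace (A : Type*) [CStarAlgebra A] : Set (WeakDual ℂ A) :=
  {τ | (∀ a : A, 0 ≤ τ (star a * a)) ∧ τ 1 = 1 ∧ ∀ a b : A, τ (a * b) = τ (b * a)}

/-- The extreme boundary of the trace space: the set of extreme points of the convex set `T(A)`.
Coerced to a type it carries the relative weak-* topology. -/
def extremeTraces (A : Type*) [CStarAlgebra A] : Set (WeakDual ℂ A) :=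
  (traceSpace A).extremePoints ℝ

/-- Simplicity of a C*-algebra: it is nonzero, and its only norm-closed two-sided ideals
are `0` and the whole algebra. -/
def IsSimpleCStarAlgebra (A : Type*) [CStarAlgebra A] : Prop :=
  Nontrivial A ∧ ∀ I : TwoSidedIdeal A, IsClosed (I : Set A) → I = ⊥ ∨ I = ⊤

/-! The positive part of a tracial functional is again tracial, so the positive traces form a cone
with Riesz decomposition, whose base is `T(A)`. In such a cone the closed convex hull of a compact
set of extreme traces is a face, and Milman's converse shows that disjoint compact sets `C`, `D` of
extreme traces have disjoint hulls. Traces `σ`, `ρ` in the two hulls therefore have no common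
minorant but `0`, which means `(σ - ρ)⁺ = σ`. Evaluated at `1`, the formula for the positive part
says that the supremum of `σ - ρ` over `0 ≤ a ≤ 1` is `1`. The minimax theorem then yields one `a`
that works for all pairs at once: a Urysohn lemma for the extreme boundary
(`exists_urysohn_extremeTraces`).

Compactness of the boundary makes closed level sets of `f` compact. Cutting the range of `f` into
`N` layers of height `‖f‖ / N` and adding one Urysohn contraction per layer approximates `f` within
`2‖f‖ / N`, and the norm of the sum is at most `N · ‖f‖ / N = ‖f‖`. -/

/-! ### Milman's converse to Krein-Milman -/

section Milman

variable {E : Type*} [AddCommGroup E] [Module ℝ E] [TopologicalSpace E]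
  [IsTopologicalAddGroup E] [ContinuousSMul ℝ E]

theorem isCompact_convexJoin {K L : Set E} (hK : IsCompact K) (hL : IsCompact L) :
    IsCompact (convexJoin ℝ K L) := by
  have h : convexJoin ℝ K L =
      (fun p : E × E × ℝ => p.1 + p.2.2 • (p.2.1 - p.1)) '' (K ×ˢ L ×ˢ Set.Icc (0 : ℝ) 1) := by
    ext x
    simp only [mem_convexJoin, segment_eq_image', Set.mem_image, Set.mem_prod, Prod.exists]
    constructor
    · rintro ⟨a, ha, b, hb, t, ht, rfl⟩
      exact ⟨a, b, t, ⟨ha, hb, ht⟩, rfl⟩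
    · rintro ⟨a, b, t, ⟨ha, hb, ht⟩, rfl⟩
      exact ⟨a, ha, b, hb, t, ht, rfl⟩
  rw [h]
  exact (hK.prod (hL.prod isCompact_Icc)).image (by fun_prop)

/-- The join of the two hulls is compact and convex, so it contains the closed hull of the union. An
extreme point on a segment between the hulls must be an endpoint. -/
theorem mem_closedConvexHull_or_of_mem_extremePoints [T2Space E] {D S S' : Set E} {x : E}
    (hD : IsCompact (closedConvexHull ℝ D)) (hS : S ⊆ D) (hS' : S' ⊆ D)
    (hx : x ∈ (closedConvexHull ℝ D).extremePoints ℝ)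
    (hxS : x ∈ closedConvexHull ℝ (S ∪ S')) :
    x ∈ closedConvexHull ℝ S ∨ x ∈ closedConvexHull ℝ S' := by
  rcases S.eq_empty_or_nonempty with rfl | hSne
  · right; simpa using hxS
  rcases S'.eq_empty_or_nonempty with rfl | hSne'
  · left; simpa using hxS
  have hSD : closedConvexHull ℝ S ⊆ closedConvexHull ℝ D := (closedConvexHull ℝ).monotone hS
  have hSD' : closedConvexHull ℝ S' ⊆ closedConvexHull ℝ D := (closedConvexHull ℝ).monotone hS'
  have hK := hD.of_isClosed_subset isClosed_closedConvexHull hSD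
  have hK' := hD.of_isClosed_subset isClosed_closedConvexHull hSD'
  have hsub : closedConvexHull ℝ (S ∪ S') ⊆
      convexJoin ℝ (closedConvexHull ℝ S) (closedConvexHull ℝ S') := by
    refine closedConvexHull_min (Set.union_subset ?_ ?_)
      (convex_closedConvexHull.convexJoin convex_closedConvexHull) (isCompact_convexJoin hK hK').isClosed
    · exact subset_closedConvexHull.trans
        (subset_convexJoin_left (hSne'.mono subset_closedConvexHull))
    · exact subset_closedConvexHull.trans
        (subset_convexJoin_right (hSne.mono subset_closedConvexHull))
  obtain ⟨a, ha, b, hb, hab⟩ := mem_convexJoin.1 (hsub hxS)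
  rcases (mem_extremePoints_iff_forall_segment.1 hx).2 a (hSD ha) b (hSD' hb) hab with h | h
  · exact Or.inl (h ▸ ha)
  · exact Or.inr (h ▸ hb)

/-- **Milman's converse** to the Krein-Milman theorem. -/
theorem extremePoints_closedConvexHull_subset [T2Space E] [LocallyConvexSpace ℝ E] {D : Set E}
    (hD : IsCompact D) (hK : IsCompact (closedConvexHull ℝ D)) :
    (closedConvexHull ℝ D).extremePoints ℝ ⊆ D := by
  intro x hx
  by_contra hxD
  have key : x ∉ closedConvexHull ℝ (D ∩ D) := by
    -- Compactness reduces the claim to small pieces of `D`; near `y ≠ x` a convex neighbourhood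
    -- whose closure misses `x` suffices.
    refine hD.induction_on (p := fun S => x ∉ closedConvexHull ℝ (S ∩ D)) ?_ ?_ ?_ ?_
    · have : closedConvexHull ℝ (∅ : Set E) = ∅ :=
        Set.subset_empty_iff.1 (closedConvexHull_min subset_rfl convex_empty isClosed_empty)
      simp [this]
    · intro s t hst ht hs
      exact ht ((closedConvexHull ℝ).monotone (Set.inter_subset_inter_left _ hst) hs)
    · intro s t hs ht hst
      rw [Set.union_inter_distrib_right] at hst
      rcases mem_closedConvexHull_or_of_mem_extremePoints hK Set.inter_subset_right
        Set.inter_subset_right hx hst with h | h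
      · exact hs h
      · exact ht h
    · intro y hy
      have hyx : y ≠ x := fun h => hxD (h ▸ hy)
      obtain ⟨U, hU, hUc, hxU⟩ : ∃ U ∈ 𝓝 y, IsClosed U ∧ U ⊆ {x}ᶜ := by
        obtain ⟨U, hU, hUc⟩ := exists_mem_nhds_isClosed_subset (isOpen_compl_singleton.mem_nhds hyx)
        exact ⟨U, hU, hUc⟩
      obtain ⟨V, hV, hVc, hVU⟩ := (locallyConvexSpace_iff_exists_convex_subset ℝ E).1 ‹_› y U hU
      refine ⟨V, mem_nhdsWithin_of_mem_nhds hV, fun h => ?_⟩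
      have : closedConvexHull ℝ (V ∩ D) ⊆ U :=
        (closedConvexHull_min (Set.inter_subset_left.trans subset_closure) hVc.closure
          isClosed_closure).trans (hUc.closure_subset_iff.2 hVU)
      exact hxU (this h) rfl
  rw [Set.inter_self] at key
  exact key hx.1

end Milman

/-! ### Faces of a cone with Riesz decomposition and compact base -/

section RieszCone

variable {E : Type*} [AddCommGroup E] [Module ℝ E] [TopologicalSpace E]

/-- A closed convex cone with the Riesz decomposition property, strictly positive functional `ℓ`,
and compact truncation `{x ∈ P | ℓ x ≤ 1}`. -/
structure IsRieszCone (P : Set E) (ℓ : E →L[ℝ] ℝ) : Prop where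
  add_mem : ∀ x ∈ P, ∀ y ∈ P, x + y ∈ P
  smul_mem : ∀ c : ℝ, 0 ≤ c → ∀ x ∈ P, c • x ∈ P
  isClosed : IsClosed P
  nonneg : ∀ x ∈ P, 0 ≤ ℓ x
  eq_zero : ∀ x ∈ P, ℓ x = 0 → x = 0
  isCompact : IsCompact {x ∈ P | ℓ x ≤ 1}
  riesz : ∀ x ∈ P, ∀ y ∈ P, ∀ z ∈ P, y + z - x ∈ P →
    ∃ y' ∈ P, ∃ z' ∈ P, x = y' + z' ∧ y - y' ∈ P ∧ z - z' ∈ P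

namespace IsRieszCone

variable {P : Set E} {ℓ : E →L[ℝ] ℝ}

theorem convex_base (h : IsRieszCone P ℓ) : Convex ℝ {x ∈ P | ℓ x = 1} := by
  rintro x ⟨hx, hx1⟩ y ⟨hy, hy1⟩ a b ha hb hab
  refine ⟨h.add_mem _ (h.smul_mem a ha x hx) _ (h.smul_mem b hb y hy), ?_⟩
  simp [hx1, hy1, hab]

theorem isCompact_base (h : IsRieszCone P ℓ) : IsCompact {x ∈ P | ℓ x = 1} := by
  have : {x ∈ P | ℓ x = 1} = {x ∈ P | ℓ x ≤ 1} ∩ {x | ℓ x = 1} := by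
    ext x
    simp only [Set.mem_ofPred_eq, Set.mem_inter_iff]
    constructor
    · rintro ⟨hx, h1⟩; exact ⟨⟨hx, h1.le⟩, h1⟩
    · rintro ⟨⟨hx, -⟩, h1⟩; exact ⟨hx, h1⟩
  rw [this]
  exact h.isCompact.inter_right (isClosed_eq ℓ.continuous continuous_const)

theorem eq_smul_of_mem_extremePoints (h : IsRieszCone P ℓ) {x y : E}
    (hx : x ∈ {x ∈ P | ℓ x = 1}.extremePoints ℝ) (hy : y ∈ P) (hxy : x - y ∈ P) :
    y = ℓ y • x := by
  have hx1 : ℓ x = 1 := hx.1.2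
  rcases (h.nonneg y hy).eq_or_lt with h0 | h0
  · rw [h.eq_zero y hy h0.symm]; simp
  have h1 := h.nonneg _ hxy
  rw [map_sub, hx1] at h1
  rcases h1.eq_or_lt with h1 | h1
  · have := h.eq_zero _ hxy (by rw [map_sub, hx1, ← h1])
    rw [sub_eq_zero] at this
    rw [← this, hx1, one_smul]
  have key := hx.2 (x₁ := (ℓ y)⁻¹ • y) ⟨h.smul_mem _ (by positivity) y hy, by simp [h0.ne']⟩
    (x₂ := (1 - ℓ y)⁻¹ • (x - y)) ⟨h.smul_mem _ (by positivity) _ hxy, by simp [hx1, h1.ne']⟩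
    ⟨ℓ y, 1 - ℓ y, h0, h1, by ring, by simp [smul_smul, h0.ne', h1.ne']⟩
  conv_rhs => rw [← key, smul_smul, mul_inv_cancel₀ h0.ne', one_smul]

/-- If `p.1 = a x₁ + b x₂`, Riesz decomposition splits the minorant `p.2` accordingly, so the whole
pair `p` decomposes and its extremality applies. -/
theorem fst_mem_extremePoints (h : IsRieszCone P ℓ) {F : Set E}
    (hFP : F ⊆ {x ∈ P | ℓ x = 1}) {p : E × E}
    (hp : p ∈ {p : E × E | p.1 ∈ F ∧ p.2 ∈ P ∧ p.1 - p.2 ∈ P}.extremePoints ℝ) :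
    p.1 ∈ F.extremePoints ℝ := by
  obtain ⟨⟨hx, hy, hxy⟩, hext⟩ := hp
  refine ⟨hx, ?_⟩
  rintro x₁ hx₁ x₂ hx₂ ⟨a, b, ha, hb, hab, hxab⟩
  rw [← hxab] at hxy
  obtain ⟨y₁, hy₁, y₂, hy₂, hyy, h₁, h₂⟩ := h.riesz _ hy _ (h.smul_mem a ha.le _ (hFP hx₁).1) _
    (h.smul_mem b hb.le _ (hFP hx₂).1) hxy
  have aux : ∀ {c : ℝ} {x y : E}, 0 < c → c • x - y ∈ P → x - c⁻¹ • y ∈ P := by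
    intro c x y hc hcxy
    have := h.smul_mem c⁻¹ (by positivity) _ hcxy
    rwa [smul_sub, smul_smul, inv_mul_cancel₀ hc.ne', one_smul] at this
  have := hext (x₁ := (x₁, a⁻¹ • y₁)) ⟨hx₁, h.smul_mem _ (by positivity) _ hy₁, aux ha h₁⟩
    (x₂ := (x₂, b⁻¹ • y₂)) ⟨hx₂, h.smul_mem _ (by positivity) _ hy₂, aux hb h₂⟩
    ⟨a, b, ha, hb, hab, by
      ext
      · simpa using hxab
      · simp [smul_smul, ha.ne', hb.ne', hyy]⟩
  exact congrArg Prod.fst this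

variable [T2Space E]

theorem closedConvexHull_subset (h : IsRieszCone P ℓ) {D : Set E}
    (hD : D ⊆ {x ∈ P | ℓ x = 1}.extremePoints ℝ) :
    closedConvexHull ℝ D ⊆ {x ∈ P | ℓ x = 1} :=
  closedConvexHull_min (hD.trans extremePoints_subset) h.convex_base h.isCompact_base.isClosed

theorem isCompact_closedConvexHull (h : IsRieszCone P ℓ) {D : Set E}
    (hD : D ⊆ {x ∈ P | ℓ x = 1}.extremePoints ℝ) : IsCompact (closedConvexHull ℝ D) :=
  h.isCompact_base.of_isClosed_subset isClosed_closedConvexHull (h.closedConvexHull_subset hD)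

variable [IsTopologicalAddGroup E]

theorem isCompact_minorants (h : IsRieszCone P ℓ) {F : Set E} (hF : IsCompact F)
    (hFP : F ⊆ {x ∈ P | ℓ x = 1}) :
    IsCompact {p : E × E | p.1 ∈ F ∧ p.2 ∈ P ∧ p.1 - p.2 ∈ P} := by
  refine (hF.prod h.isCompact).of_isClosed_subset ?_ ?_
  · exact (hF.isClosed.preimage continuous_fst).inter
      ((h.isClosed.preimage continuous_snd).inter
        (h.isClosed.preimage (continuous_fst.sub continuous_snd)))
  · rintro ⟨x, y⟩ ⟨hx, hy, hxy⟩
    have := h.nonneg _ hxy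
    rw [map_sub, (hFP hx).2] at this
    exact ⟨hx, hy, by simpa using this⟩

variable [ContinuousSMul ℝ E] [LocallyConvexSpace ℝ E]

/-- This is the face property in terms of minorants. A separating functional need only be tested at
extreme pairs, where the first entry lies in `D` and the minorant is a multiple of it. -/
theorem inv_smul_mem_closedConvexHull (h : IsRieszCone P ℓ) {D : Set E} (hDc : IsCompact D)
    (hD : D ⊆ {x ∈ P | ℓ x = 1}.extremePoints ℝ) {x y : E} (hx : x ∈ closedConvexHull ℝ D)
    (hy : y ∈ P) (hxy : x - y ∈ P) (hy0 : ℓ y ≠ 0) :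
    (ℓ y)⁻¹ • y ∈ closedConvexHull ℝ D := by
  by_contra hcon
  have hFP := h.closedConvexHull_subset hD
  have hF := h.isCompact_closedConvexHull hD
  obtain ⟨f, u, hfu, huy⟩ := geometric_hahn_banach_closed_point
    (convex_closedConvexHull (s := D)) isClosed_closedConvexHull hcon
  have hypos : 0 < ℓ y := (h.nonneg y hy).lt_of_ne' hy0
  -- Subtracting `u • ℓ` makes the separation homogeneous: `g < 0` on the hull and `g y > 0`.
  set g : E →L[ℝ] ℝ := f - u • ℓ with hg
  have hgy : 0 < g y := by
    have : u < (ℓ y)⁻¹ * f y := by simpa using huy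
    rw [inv_mul_eq_div, lt_div_iff₀ hypos] at this
    simpa [hg] using this
  set M := {p : E × E | p.1 ∈ closedConvexHull ℝ D ∧ p.2 ∈ P ∧ p.1 - p.2 ∈ P} with hM
  have hMc : IsCompact M := h.isCompact_minorants hF hFP
  let G : StrongDual ℝ (E × E) := g.comp (ContinuousLinearMap.snd ℝ E E)
  have hexp : IsExposed ℝ M (G.toExposed M) := ContinuousLinearMap.toExposed.isExposed
  obtain ⟨m, hmM, hmax⟩ := hMc.exists_isMaxOn ⟨(x, y), hx, hy, hxy⟩ G.continuous.continuousOn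
  obtain ⟨p, hp⟩ := (hexp.isCompact hMc).extremePoints_nonempty ⟨m, hmM, hmax⟩
  have hpM := hexp.isExtreme.extremePoints_subset_extremePoints hp
  have hpD := extremePoints_closedConvexHull_subset hDc hF (h.fst_mem_extremePoints hFP hpM)
  have hp2 := h.eq_smul_of_mem_extremePoints (hD hpD) hpM.1.2.1 hpM.1.2.2
  have h1 : g y ≤ g p.2 := hp.1.2 (x, y) ⟨hx, hy, hxy⟩
  have h2 : g p.1 < 0 := by
    have := hfu _ hpM.1.1
    have h1 : ℓ p.1 = 1 := (hFP hpM.1.1).2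
    simpa [hg, h1] using this
  -- Now `0 < g y ≤ ℓ p.2 * g p.1`, although `ℓ p.2 ≥ 0` and `g p.1 < 0`.
  rw [hp2, map_smul, smul_eq_mul] at h1
  nlinarith [h.nonneg _ hpM.1.2.1]

theorem isExtreme_closedConvexHull (h : IsRieszCone P ℓ) {D : Set E} (hDc : IsCompact D)
    (hD : D ⊆ {x ∈ P | ℓ x = 1}.extremePoints ℝ) :
    IsExtreme ℝ {x ∈ P | ℓ x = 1} (closedConvexHull ℝ D) := by
  refine ⟨h.closedConvexHull_subset hD, ?_⟩
  rintro x ⟨hx, hx1⟩ y ⟨hy, hy1⟩ z hz ⟨a, b, ha, hb, hab, rfl⟩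
  have := h.inv_smul_mem_closedConvexHull hDc hD hz (h.smul_mem a ha.le x hx)
    (by simpa using h.smul_mem b hb.le y hy) (by simp [hx1, ha.ne'])
  simpa [hx1, ha.ne'] using this

/-- A nonempty intersection of the two compact faces would have an extreme point. It is extreme in
the base, hence in both hulls, and Milman's converse puts it in both `C` and `D`. -/
theorem disjoint_closedConvexHull (h : IsRieszCone P ℓ) {C D : Set E} (hCc : IsCompact C)
    (hC : C ⊆ {x ∈ P | ℓ x = 1}.extremePoints ℝ) (hDc : IsCompact D)
    (hD : D ⊆ {x ∈ P | ℓ x = 1}.extremePoints ℝ) (hCD : Disjoint C D) :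
    Disjoint (closedConvexHull ℝ C) (closedConvexHull ℝ D) := by
  rw [Set.disjoint_iff_inter_eq_empty, ← Set.not_nonempty_iff_eq_empty]
  intro hne
  have hFC := h.isCompact_closedConvexHull hC
  have hFD := h.isCompact_closedConvexHull hD
  obtain ⟨x, hx⟩ := (hFC.inter hFD).extremePoints_nonempty hne
  have hT := ((h.isExtreme_closedConvexHull hCc hC).inter
    (h.isExtreme_closedConvexHull hDc hD)).extremePoints_subset_extremePoints hx
  have hxC : x ∈ C := extremePoints_closedConvexHull_subset hCc hFC
    (inter_extremePoints_subset_extremePoints_of_subset (h.closedConvexHull_subset hC) ⟨hx.1.1, hT⟩)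
  have hxD : x ∈ D := extremePoints_closedConvexHull_subset hDc hFD
    (inter_extremePoints_subset_extremePoints_of_subset (h.closedConvexHull_subset hD) ⟨hx.1.2, hT⟩)
  exact hCD.le_bot ⟨hxC, hxD⟩

/-- The closed convex hulls of disjoint compact sets of extreme points are mutually singular. -/
theorem eq_zero_of_le_closedConvexHull (h : IsRieszCone P ℓ) {C D : Set E} (hCc : IsCompact C)
    (hC : C ⊆ {x ∈ P | ℓ x = 1}.extremePoints ℝ) (hDc : IsCompact D)
    (hD : D ⊆ {x ∈ P | ℓ x = 1}.extremePoints ℝ) (hCD : Disjoint C D) {x y z : E}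
    (hx : x ∈ closedConvexHull ℝ C) (hy : y ∈ closedConvexHull ℝ D) (hz : z ∈ P)
    (hxz : x - z ∈ P) (hyz : y - z ∈ P) : z = 0 := by
  by_contra hz0
  have hℓ : ℓ z ≠ 0 := fun h0 => hz0 (h.eq_zero z hz h0)
  exact (h.disjoint_closedConvexHull hCc hC hDc hD hCD).le_bot
    ⟨h.inv_smul_mem_closedConvexHull hCc hC hx hz hxz hℓ,
      h.inv_smul_mem_closedConvexHull hDc hD hy hz hyz hℓ⟩

end IsRieszCone

end RieszCone

/-! ### Decomposition and extension on the positive cone of a C⋆-algebra -/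

section CStarCone

variable {A : Type*} [CStarAlgebra A] [PartialOrder A] [StarOrderedRing A]

/-- Approximate noncommutative Riesz decomposition in a C⋆-algebra. -/
theorem exists_norm_sub_mul_star_add_le {b x y : A} (hb : 0 ≤ b) (hx : 0 ≤ x) (hy : 0 ≤ y)
    (hbxy : b ≤ x + y) {ε : ℝ} (hε : 0 < ε) :
    ∃ z w : A, ‖b - (z * star z + w * star w)‖ ≤ ε ∧ star z * z ≤ x ∧ star w * w ≤ y := by
  -- With `e = (x + y + ε)^(-1/2)`, the witnesses are `z = √b e √x` and `w = √b e √y`; the error is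
  -- `ε √b e² √b`. Both bounds come from `e b e ≤ 1`.
  have hεA : IsStrictlyPositive (algebraMap ℝ A ε) :=
    ⟨algebraMap_nonneg A hε.le, (IsUnit.mk0 ε hε.ne').map (algebraMap ℝ A)⟩
  have hd : IsStrictlyPositive (x + y + algebraMap ℝ A ε) :=
    isStrictlyPositive_add (Or.inr ⟨add_nonneg hx hy, hεA⟩)
  have hone := CFC.conjugate_rpow_neg_one_half _ hd
  have he : IsSelfAdjoint ((x + y + algebraMap ℝ A ε) ^ (-(1 / 2) : ℝ)) :=
    .of_nonneg CFC.rpow_nonneg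
  set e := (x + y + algebraMap ℝ A ε) ^ (-(1 / 2) : ℝ)
  have hsb : IsSelfAdjoint (CFC.sqrt b) := .of_nonneg (CFC.sqrt_nonneg b)
  have hbb := CFC.sqrt_mul_sqrt_self b hb
  have hebe : e * b * e ≤ 1 := by
    rw [← hone]
    refine he.conjugate_le_conjugate (hbxy.trans ?_)
    exact le_add_of_nonneg_right hεA.nonneg
  have key : ∀ u : A, 0 ≤ u →
      (CFC.sqrt b * e * CFC.sqrt u) * star (CFC.sqrt b * e * CFC.sqrt u)
        = CFC.sqrt b * (e * u * e) * CFC.sqrt b ∧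
      star (CFC.sqrt b * e * CFC.sqrt u) * (CFC.sqrt b * e * CFC.sqrt u) ≤ u := by
    intro u hu
    have hsu : IsSelfAdjoint (CFC.sqrt u) := .of_nonneg (CFC.sqrt_nonneg u)
    have huu := CFC.sqrt_mul_sqrt_self u hu
    simp only [star_mul, hsb.star_eq, he.star_eq, hsu.star_eq]
    constructor
    · conv_rhs => rw [← huu]
      simp only [mul_assoc]
    · calc CFC.sqrt u * (e * CFC.sqrt b) * (CFC.sqrt b * e * CFC.sqrt u)
          = CFC.sqrt u * (e * (CFC.sqrt b * CFC.sqrt b) * e) * CFC.sqrt u := by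
            simp only [mul_assoc]
        _ = CFC.sqrt u * (e * b * e) * CFC.sqrt u := by rw [hbb]
        _ ≤ CFC.sqrt u * 1 * CFC.sqrt u := hsu.conjugate_le_conjugate hebe
        _ = u := by rw [mul_one, huu]
  refine ⟨_, _, ?_, (key x hx).2, (key y hy).2⟩
  rw [(key x hx).1, (key y hy).1]
  have hsum : b - (CFC.sqrt b * (e * x * e) * CFC.sqrt b + CFC.sqrt b * (e * y * e) * CFC.sqrt b)
      = ε • ((CFC.sqrt b * e) * star (CFC.sqrt b * e)) := by
    have h1 : e * x * e + e * y * e = 1 - ε • (e * e) := by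
      rw [eq_sub_iff_add_eq]
      conv_rhs => rw [← hone]
      rw [mul_add, mul_add, add_mul, add_mul, Algebra.algebraMap_eq_smul_one]
      simp
    rw [← add_mul, ← mul_add, h1, mul_sub, sub_mul, mul_one, hbb, sub_sub_cancel, star_mul,
      hsb.star_eq, he.star_eq]
    simp [mul_assoc]
  rw [hsum, norm_smul, Real.norm_of_nonneg hε.le, CStarRing.norm_self_mul_star]
  have h2 : ‖star (CFC.sqrt b * e) * (CFC.sqrt b * e)‖ ≤ 1 := by
    rw [CStarAlgebra.norm_le_one_iff_of_nonneg _ (star_mul_self_nonneg _)]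
    have : star (CFC.sqrt b * e) * (CFC.sqrt b * e) = e * b * e := by
      rw [star_mul, hsb.star_eq, he.star_eq, ← mul_assoc, mul_assoc e, hbb]
    rw [this]
    exact hebe
  rw [CStarRing.norm_star_mul_self] at h2
  nlinarith

/-- An additive, positively homogeneous function on the positive cone extends to a real-linear
functional vanishing on skew-adjoint elements. -/
theorem exists_linearMap_of_additive_on_nonneg (p : A → ℝ)
    (hadd : ∀ x y : A, 0 ≤ x → 0 ≤ y → p (x + y) = p x + p y)
    (hsmul : ∀ (c : ℝ) (x : A), 0 ≤ c → 0 ≤ x → p (c • x) = c * p x) :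
    ∃ L : A →ₗ[ℝ] ℝ, (∀ a : A, 0 ≤ a → L a = p a) ∧
      ∀ a : A, IsSelfAdjoint a → L (Complex.I • a) = 0 := by
  have hsub : ∀ x y x' y' : A, 0 ≤ x → 0 ≤ y → 0 ≤ x' → 0 ≤ y' → x - y = x' - y' →
      p x - p y = p x' - p y' := by
    intro x y x' y' hx hy hx' hy' h
    have h1 : x + y' = x' + y := by
      rw [sub_eq_sub_iff_add_eq_add] at h
      exact h
    have h2 := congrArg p h1
    rw [hadd _ _ hx hy', hadd _ _ hx' hy] at h2
    linarith
  have h0 : p 0 = 0 := by simpa using hsmul 0 0 le_rfl le_rfl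
  -- By `hsub`, any way of writing `x` as a difference of positive elements gives the same value,
  -- and this yields linearity.
  let q : selfAdjoint A → ℝ := fun x => p ((x : A)⁺) - p ((x : A)⁻)
  have hq : ∀ (x : selfAdjoint A) (a b : A), 0 ≤ a → 0 ≤ b → (x : A) = a - b →
      q x = p a - p b := by
    intro x a b ha hb h
    refine hsub _ _ _ _ (CFC.posPart_nonneg _) (CFC.negPart_nonneg _) ha hb ?_
    rw [CFC.posPart_sub_negPart _ x.2, h]
  have hqq : ∀ x : selfAdjoint A, (x : A) = (x : A)⁺ - (x : A)⁻ := fun x =>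
    (CFC.posPart_sub_negPart _ x.2).symm
  let Q : selfAdjoint A →ₗ[ℝ] ℝ :=
    { toFun := q
      map_add' := by
        intro x y
        rw [hq (x + y) ((x : A)⁺ + (y : A)⁺) ((x : A)⁻ + (y : A)⁻)
          (add_nonneg (CFC.posPart_nonneg _) (CFC.posPart_nonneg _))
          (add_nonneg (CFC.negPart_nonneg _) (CFC.negPart_nonneg _)),
          hadd _ _ (CFC.posPart_nonneg _) (CFC.posPart_nonneg _),
          hadd _ _ (CFC.negPart_nonneg _) (CFC.negPart_nonneg _)]
        · simp only [q]; ring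
        · rw [AddSubgroup.coe_add, add_sub_add_comm, ← hqq, ← hqq]
      map_smul' := by
        intro c x
        rcases le_total 0 c with hc | hc
        · rw [hq (c • x) (c • (x : A)⁺) (c • (x : A)⁻)
            (smul_nonneg hc (CFC.posPart_nonneg _)) (smul_nonneg hc (CFC.negPart_nonneg _)),
            hsmul _ _ hc (CFC.posPart_nonneg _), hsmul _ _ hc (CFC.negPart_nonneg _)]
          · simp only [q, RingHom.id_apply, smul_eq_mul]; ring
          · rw [← smul_sub, ← hqq]; rfl
        · have hc' : 0 ≤ -c := neg_nonneg.2 hc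
          rw [hq (c • x) ((-c) • (x : A)⁻) ((-c) • (x : A)⁺)
            (smul_nonneg hc' (CFC.negPart_nonneg _)) (smul_nonneg hc' (CFC.posPart_nonneg _)),
            hsmul _ _ hc' (CFC.posPart_nonneg _), hsmul _ _ hc' (CFC.negPart_nonneg _)]
          · simp only [q, RingHom.id_apply, smul_eq_mul]; ring
          · rw [← smul_sub, neg_smul, ← smul_neg, neg_sub, ← hqq]; rfl }
  refine ⟨Q ∘ₗ realPart, ?_, ?_⟩
  · intro a ha
    have := hq (realPart a) a 0 ha le_rfl (by
      rw [sub_zero, (IsSelfAdjoint.of_nonneg ha).coe_realPart])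
    rw [h0, sub_zero] at this
    exact this
  · intro a ha
    rw [LinearMap.comp_apply, realPart_I_smul, ha.imaginaryPart, neg_zero, map_zero]

end CStarCone

/-! ### Order and positive parts of tracial functionals -/

section TracialCone

/-- The cone of positive tracial functionals. -/
def positiveTraces (A : Type*) [CStarAlgebra A] : Set (WeakDual ℂ A) :=
  {τ | (∀ a : A, 0 ≤ τ (star a * a)) ∧ ∀ a b : A, τ (a * b) = τ (b * a)}

variable {A : Type*} [CStarAlgebra A]

theorem mem_traceSpace_iff {τ : WeakDual ℂ A} :
    τ ∈ traceSpace A ↔ τ ∈ positiveTraces A ∧ τ 1 = 1 :=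
  ⟨fun h => ⟨⟨h.1, h.2.2⟩, h.2.1⟩, fun h => ⟨h.1.1, h.2, h.1.2⟩⟩

variable [PartialOrder A] [StarOrderedRing A]

theorem mem_positiveTraces_iff {τ : WeakDual ℂ A} :
    τ ∈ positiveTraces A ↔ (∀ a : A, 0 ≤ a → 0 ≤ τ a) ∧ ∀ a b : A, τ (a * b) = τ (b * a) := by
  refine and_congr_left fun _ => ⟨fun h a ha => ?_, fun h a => h _ (star_mul_self_nonneg a)⟩
  obtain ⟨b, rfl⟩ := CStarAlgebra.nonneg_iff_eq_star_mul_self.1 ha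
  exact h b

theorem apply_nonneg_of_mem_positiveTraces {τ : WeakDual ℂ A} (h : τ ∈ positiveTraces A) {a : A}
    (ha : 0 ≤ a) : 0 ≤ τ a :=
  (mem_positiveTraces_iff.1 h).1 a ha

theorem re_mono_of_mem_positiveTraces {τ : WeakDual ℂ A} (h : τ ∈ positiveTraces A) {a b : A}
    (hab : a ≤ b) : (τ a).re ≤ (τ b).re := by
  have := (Complex.le_def.1 (apply_nonneg_of_mem_positiveTraces h (sub_nonneg.2 hab))).1
  simpa using this

theorem sub_mem_positiveTraces_iff {τ φ : WeakDual ℂ A} (hτ : τ ∈ positiveTraces A)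
    (hφ : φ ∈ positiveTraces A) :
    τ - φ ∈ positiveTraces A ↔ ∀ a : A, 0 ≤ a → (φ a).re ≤ (τ a).re := by
  have happ : ∀ a : A, (τ - φ) a = τ a - φ a := fun _ => rfl
  rw [mem_positiveTraces_iff]
  constructor
  · intro h a ha
    have := (Complex.le_def.1 (h.1 a ha)).1
    rw [happ] at this
    simpa using this
  · intro h
    refine ⟨fun a ha => ?_, fun a b => by rw [happ, happ, hτ.2, hφ.2]⟩
    have h1 := (Complex.le_def.1 (apply_nonneg_of_mem_positiveTraces hτ ha)).2
    have h2 := (Complex.le_def.1 (apply_nonneg_of_mem_positiveTraces hφ ha)).2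
    rw [Complex.le_def, happ, Complex.sub_re, Complex.sub_im, ← h1, ← h2]
    exact ⟨by simpa using h a ha, by simp⟩

/-- The positive part of a tracial functional exists and is tracial. -/
theorem exists_tracial_posPart (φ : WeakDual ℂ A) (hφ : ∀ a b : A, φ (a * b) = φ (b * a)) :
    ∃ ψ ∈ positiveTraces A, ∀ a : A, 0 ≤ a →
      IsLUB ((fun b => (φ b).re) '' Set.Icc 0 a) (ψ a).re := by
  obtain ⟨C, hC0, hC⟩ : ∃ C : ℝ, 0 < C ∧ ∀ b : A, |(φ b).re| ≤ C * ‖b‖ := by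
    obtain ⟨C, hC0, hC⟩ := (WeakDual.toStrongDual φ).bound
    exact ⟨C, hC0, fun b => (Complex.abs_re_le_norm _).trans (hC b)⟩
  set g : A → ℝ := fun b => (φ b).re with hg
  have hgadd : ∀ a b, g (a + b) = g a + g b := fun a b => by simp [hg]
  have hgsmul : ∀ (c : ℝ) a, g (c • a) = c * g a := fun c a => by
    simp only [hg]
    rw [← Complex.coe_smul, map_smul]
    simp
  have hgtr : ∀ a b, g (a * b) = g (b * a) := fun a b => by simp only [hg, hφ]
  let p : A → ℝ := fun a => sSup (g '' Set.Icc 0 a)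
  have hlub : ∀ a : A, 0 ≤ a → IsLUB (g '' Set.Icc 0 a) (p a) := by
    intro a ha
    refine isLUB_csSup ⟨g 0, 0, ⟨le_rfl, ha⟩, rfl⟩ ⟨C * ‖a‖, ?_⟩
    rintro _ ⟨b, hb, rfl⟩
    refine (le_abs_self _).trans ((hC b).trans ?_)
    gcongr
    exact CStarAlgebra.norm_le_norm_of_nonneg_of_le hb.1 hb.2
  have hle : ∀ a b : A, 0 ≤ b → b ≤ a → g b ≤ p a := fun a b hb hba =>
    (hlub a (hb.trans hba)).1 ⟨b, ⟨hb, hba⟩, rfl⟩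
  have hadd : ∀ x y : A, 0 ≤ x → 0 ≤ y → p (x + y) = p x + p y := by
    intro x y hx hy
    apply le_antisymm
    · refine (hlub _ (add_nonneg hx hy)).2 ?_
      rintro _ ⟨b, ⟨hb, hbxy⟩, rfl⟩
      refine le_of_forall_pos_le_add fun ε hε => ?_
      obtain ⟨z, w, hzw, hz, hw⟩ := exists_norm_sub_mul_star_add_le hb hx hy hbxy
        (div_pos hε hC0)
      have h1 := hle x _ (star_mul_self_nonneg z) hz
      have h2 := hle y _ (star_mul_self_nonneg w) hw
      have h3 := (le_abs_self _).trans (hC (b - (z * star z + w * star w)))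
      have h4 : C * ‖b - (z * star z + w * star w)‖ ≤ ε := by
        calc _ ≤ C * (ε / C) := by gcongr
          _ = ε := by field_simp
      have h5 : g b = g (b - (z * star z + w * star w)) + (g (z * star z) + g (w * star w)) := by
        rw [← hgadd, ← hgadd, sub_add_cancel]
      -- Traciality replaces `z * star z` by `star z * z`, which lies below `x`; likewise for `w`
      -- and `y`.
      rw [hgtr z, hgtr w] at h5
      simp only [hg] at h3 h5 h1 h2 ⊢
      linarith
    · rw [← le_sub_iff_add_le]
      refine (hlub x hx).2 ?_
      rintro _ ⟨b, ⟨hb, hbx⟩, rfl⟩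
      rw [le_sub_comm]
      refine (hlub y hy).2 ?_
      rintro _ ⟨c, ⟨hc, hcy⟩, rfl⟩
      have := hle (x + y) (b + c) (add_nonneg hb hc) (add_le_add hbx hcy)
      rw [hgadd] at this
      linarith
  have hp0 : p 0 = 0 := by
    refine (hlub 0 le_rfl).unique ?_
    simp [hg]
  have hsmul_le : ∀ (c : ℝ) (x : A), 0 < c → 0 ≤ x → c * p x ≤ p (c • x) := by
    intro c x hc hx
    rw [← le_div_iff₀' hc]
    refine (hlub x hx).2 ?_
    rintro _ ⟨b, ⟨hb, hbx⟩, rfl⟩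
    have := hle (c • x) (c • b) (smul_nonneg hc.le hb) (smul_le_smul_of_nonneg_left hbx hc.le)
    rw [hgsmul] at this
    rwa [le_div_iff₀' hc]
  have hsmul : ∀ (c : ℝ) (x : A), 0 ≤ c → 0 ≤ x → p (c • x) = c * p x := by
    intro c x hc hx
    rcases hc.eq_or_lt with rfl | hc
    · simp [hp0]
    refine le_antisymm ?_ (hsmul_le c x hc hx)
    have := hsmul_le c⁻¹ (c • x) (by positivity) (smul_nonneg hc.le hx)
    rw [smul_smul, inv_mul_cancel₀ hc.ne', one_smul, inv_mul_le_iff₀ hc] at this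
    exact this
  obtain ⟨L, hL, hLI⟩ := exists_linearMap_of_additive_on_nonneg p hadd hsmul
  let F : A →ₗ[ℂ] ℂ := Module.Dual.extendRCLike (𝕜 := ℂ) L
  have hF : ∀ a : A, 0 ≤ a → F a = (p a : ℂ) := by
    intro a ha
    apply Complex.ext
    · exact (Module.Dual.re_extendRCLike_apply (𝕜 := ℂ) L a).trans (hL a ha)
    · refine (Module.Dual.im_extendRCLike_apply (𝕜 := ℂ) L a).trans ?_
      have := hLI a (.of_nonneg ha)
      simpa using this
  have hp : ∀ a : A, 0 ≤ a → 0 ≤ p a := fun a ha => by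
    simpa [hg] using hle a 0 le_rfl ha
  have hFpos : ∀ a : A, 0 ≤ a → 0 ≤ F a := fun a ha => by
    rw [hF a ha]
    exact_mod_cast hp a ha
  let ψ : WeakDual ℂ A := StrongDual.toWeakDual
    ⟨F, map_continuous (PositiveLinearMap.mk₀ F hFpos)⟩
  have hψ : ∀ a, ψ a = F a := fun _ => rfl
  -- Conjugation by a unitary carries `[0, a]` into `[0, u a u*]` and preserves `g`, so `p` is
  -- unitarily invariant. Since unitaries span `A`, this invariance gives traciality.
  have hconj_le : ∀ (u : unitary A) (a : A), 0 ≤ a → p a ≤ p (u * a * star (u : A)) := by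
    intro u a ha
    refine (hlub a ha).2 ?_
    rintro _ ⟨b, ⟨hb, hba⟩, rfl⟩
    have := hle _ _ (star_right_conjugate_nonneg hb (u : A))
      (star_right_conjugate_le_conjugate hba (u : A))
    rwa [hgtr, ← mul_assoc, Unitary.coe_star_mul_self, one_mul] at this
  have hconj : ∀ (u : unitary A) (a : A), 0 ≤ a → p (u * a * star (u : A)) = p a := by
    intro u a ha
    refine le_antisymm ?_ (hconj_le u a ha)
    have := hconj_le (star u) _ (star_right_conjugate_nonneg ha (u : A))
    have h1 : (star u : unitary A) * (u * a * star (u : A)) * star ((star u : unitary A) : A)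
        = a := by
      rw [Unitary.coe_star, star_star]
      calc star (u : A) * (u * a * star (u : A)) * u
          = (star (u : A) * u) * a * (star (u : A) * u) := by simp only [mul_assoc]
        _ = a := by rw [Unitary.coe_star_mul_self, one_mul, mul_one]
    rwa [h1] at this
  have hFconj : ∀ (u : unitary A) (a : A), F (u * a * star (u : A)) = F a := by
    intro u a
    have ha : a ∈ Submodule.span ℂ {a : A | 0 ≤ a} := by
      rw [CStarAlgebra.span_nonneg]; trivial
    induction ha using Submodule.span_induction with
    | mem x hx => rw [hF x hx, hF _ (star_right_conjugate_nonneg hx _), hconj u x hx]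
    | zero => simp
    | add x y _ _ hx hy => rw [mul_add, add_mul, map_add, map_add, hx, hy]
    | smul c x _ hx => rw [mul_smul_comm, smul_mul_assoc, map_smul, map_smul, hx]
  have hFtr : ∀ a b : A, F (a * b) = F (b * a) := by
    intro a b
    have ha : a ∈ Submodule.span ℂ (unitary A : Set A) := by
      rw [CStarAlgebra.span_unitary]; trivial
    induction ha using Submodule.span_induction with
    | mem u hu =>
      have := hFconj ⟨u, hu⟩ (b * u)
      rw [← this]
      congr 1
      simp only [mul_assoc, Unitary.mul_star_self_of_mem hu, mul_one]
    | zero => simp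
    | add x y _ _ hx hy => rw [mul_add, add_mul, map_add, map_add, hx, hy]
    | smul c x _ hx => rw [mul_smul_comm, smul_mul_assoc, map_smul, map_smul, hx]
  refine ⟨ψ, mem_positiveTraces_iff.2 ⟨hFpos, hFtr⟩, fun a ha => ?_⟩
  rw [hψ, hF a ha, Complex.ofReal_re]
  exact hlub a ha

end TracialCone

/-! ### Interchanging quantifiers by minimax -/

section Minimax

/-- Sion's theorem. The loss from `c'` to `c` is needed because `Y` is not assumed compact, so the
supremum over it may not be attained. -/
theorem exists_forall_lt_of_forall_exists_le {E F : Type*} [TopologicalSpace E] [AddCommGroup E]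
    [Module ℝ E] [IsTopologicalAddGroup E] [ContinuousSMul ℝ E] [TopologicalSpace F]
    [AddCommGroup F] [Module ℝ F] [IsTopologicalAddGroup F] [ContinuousSMul ℝ F]
    {X : Set E} {Y : Set F} {f : E → F → ℝ} (hXne : X.Nonempty) (hX : Convex ℝ X)
    (hXc : IsCompact X) (hfc : ∀ y ∈ Y, Continuous fun x => f x y)
    (hf : ∀ y ∈ Y, ConvexOn ℝ X fun x => f x y) (hY : Convex ℝ Y)
    (hfc' : ∀ x ∈ X, Continuous (f x)) (hf' : ∀ x ∈ X, ConcaveOn ℝ Y (f x)) {c c' : ℝ}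
    (hc : c < c') (h : ∀ x ∈ X, ∃ y ∈ Y, c' ≤ f x y) : ∃ y ∈ Y, ∀ x ∈ X, c < f x y := by
  have hmono : @Monotone ℝ EReal _ _ Real.toEReal := EReal.coe_strictMono.monotone
  have hmm : ⨅ x ∈ X, ⨆ y ∈ Y, (f x y : EReal) = ⨆ y ∈ Y, ⨅ x ∈ X, (f x y : EReal) :=
    Sion.minimax' hXne hX hXc
      (fun y hy => (continuous_coe_real_ereal.comp (hfc y hy)).lowerSemicontinuous
        |>.lowerSemicontinuousOn _)
      (fun y hy => QuasiconvexOn.monotone_comp (g := Real.toEReal) hmono (hf y hy).quasiconvexOn) hY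
      (fun x hx => (continuous_coe_real_ereal.comp (hfc' x hx)).upperSemicontinuous
        |>.upperSemicontinuousOn _)
      (fun x hx => QuasiconcaveOn.monotone_comp (g := Real.toEReal) hmono (hf' x hx).quasiconcaveOn)
  have hlow : (c' : EReal) ≤ ⨅ x ∈ X, ⨆ y ∈ Y, (f x y : EReal) := by
    refine le_iInf₂ fun x hx => ?_
    obtain ⟨y, hy, hxy⟩ := h x hx
    exact le_iSup₂_of_le y hy (EReal.coe_le_coe_iff.2 hxy)
  rw [hmm] at hlow
  obtain ⟨y, hy⟩ := lt_iSup_iff.1 ((EReal.coe_lt_coe_iff.2 hc).trans_le hlow)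
  obtain ⟨hyY, hy⟩ := lt_iSup_iff.1 hy
  exact ⟨y, hyY, fun x hx => EReal.coe_lt_coe_iff.1 (hy.trans_le (iInf₂_le x hx))⟩

theorem exists_forall_lt_sub_of_forall_exists_le {E F : Type*} [TopologicalSpace E]
    [AddCommGroup E] [Module ℝ E] [IsTopologicalAddGroup E] [ContinuousSMul ℝ E]
    [TopologicalSpace F] [AddCommGroup F] [Module ℝ F] [IsTopologicalAddGroup F]
    [ContinuousSMul ℝ F] {K L : Set E} {Y : Set F} (e : F → E →L[ℝ] ℝ)
    (he : ∀ x, Continuous fun y => e y x) (he' : ∀ x, IsLinearMap ℝ fun y => e y x)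
    (hKne : K.Nonempty) (hK : Convex ℝ K) (hKc : IsCompact K)
    (hLne : L.Nonempty) (hL : Convex ℝ L) (hLc : IsCompact L) (hY : Convex ℝ Y) {c c' : ℝ}
    (hc : c < c') (h : ∀ x ∈ K, ∀ z ∈ L, ∃ y ∈ Y, c' ≤ e y x - e y z) :
    ∃ y ∈ Y, ∀ x ∈ K, ∀ z ∈ L, c < e y x - e y z := by
  obtain ⟨y, hy, hyc⟩ := exists_forall_lt_of_forall_exists_le
    (X := K ×ˢ L) (Y := Y) (f := fun p y => e y p.1 - e y p.2) (hKne.prod hLne) (hK.prod hL)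
    (hKc.prod hLc)
    (fun y _ => ((e y).continuous.comp continuous_fst).sub ((e y).continuous.comp continuous_snd))
    (fun y _ => by
      refine ⟨hK.prod hL, fun p _ q _ s t _ _ _ => le_of_eq ?_⟩
      simp only [Prod.fst_add, Prod.snd_add, Prod.smul_fst, Prod.smul_snd, map_add, map_smul,
        smul_eq_mul]
      ring)
    hY (fun p _ => (he p.1).sub (he p.2))
    (fun p _ => by
      refine ⟨hY, fun a _ b _ s t _ _ _ => le_of_eq ?_⟩
      simp only [(he' _).map_add, (he' _).map_smul, smul_eq_mul]
      ring)
    hc (fun p hp => h p.1 hp.1 p.2 hp.2)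
  exact ⟨y, hy, fun x hx z hz => hyc (x, z) ⟨hx, hz⟩⟩

end Minimax

/-! ### The cone of traces and separation on its extreme boundary -/

section TraceBoundary

instance WeakDual.instIsScalarTowerReal (A : Type*) [CStarAlgebra A] :
    IsScalarTower ℝ ℂ (WeakDual ℂ A) :=
  ⟨fun x y z => DFunLike.ext _ _ fun a => smul_assoc x y (z a)⟩

instance WeakDual.instLocallyConvexSpaceReal (A : Type*) [CStarAlgebra A] :
    LocallyConvexSpace ℝ (WeakDual ℂ A) :=
  (WeakDual.withSeminorms (𝕜 := ℂ) (E := A)).toLocallyConvexSpace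

/-- The real part of the evaluation of functionals at `a`, as a weak-* continuous functional. -/
noncomputable def reEval {A : Type*} [CStarAlgebra A] (a : A) : WeakDual ℂ A →L[ℝ] ℝ where
  toFun φ := (φ a).re
  map_add' φ ψ := by
    have : (φ + ψ) a = φ a + ψ a := rfl
    rw [this, Complex.add_re]
  map_smul' c φ := by
    have : (c • φ) a = c • φ a := rfl
    rw [this]; simp
  cont := Complex.continuous_re.comp (WeakDual.eval_continuous a)

theorem reEval_apply {A : Type*} [CStarAlgebra A] (a : A) (φ : WeakDual ℂ A) :
    reEval a φ = (φ a).re := rfl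

variable {A : Type*} [CStarAlgebra A]

theorem isClosed_positiveTraces : IsClosed (positiveTraces A) := by
  have : positiveTraces A = (⋂ a : A, {τ | 0 ≤ τ (star a * a)}) ∩
      ⋂ a : A, ⋂ b : A, {τ : WeakDual ℂ A | τ (a * b) = τ (b * a)} := by
    ext τ
    simp [positiveTraces]
  rw [this]
  refine (isClosed_iInter fun a => ?_).inter (isClosed_iInter fun a => isClosed_iInter fun b => ?_)
  · exact isClosed_le continuous_const (WeakDual.eval_continuous _)
  · exact isClosed_eq (WeakDual.eval_continuous _) (WeakDual.eval_continuous _)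

theorem add_mem_positiveTraces {τ φ : WeakDual ℂ A} (hτ : τ ∈ positiveTraces A)
    (hφ : φ ∈ positiveTraces A) : τ + φ ∈ positiveTraces A := by
  have happ : ∀ a : A, (τ + φ) a = τ a + φ a := fun _ => rfl
  refine ⟨fun a => ?_, fun a b => ?_⟩
  · rw [happ]; exact add_nonneg (hτ.1 a) (hφ.1 a)
  · rw [happ, happ, hτ.2, hφ.2]

variable [PartialOrder A] [StarOrderedRing A]

theorem ofReal_re_apply_of_mem_positiveTraces {τ : WeakDual ℂ A} (h : τ ∈ positiveTraces A) {a : A}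
    (ha : 0 ≤ a) : ((τ a).re : ℂ) = τ a :=
  Complex.ext rfl (Complex.le_def.1 (apply_nonneg_of_mem_positiveTraces h ha)).2

theorem re_nonneg_of_mem_positiveTraces {τ : WeakDual ℂ A} (h : τ ∈ positiveTraces A) {a : A}
    (ha : 0 ≤ a) : 0 ≤ (τ a).re :=
  (Complex.le_def.1 (apply_nonneg_of_mem_positiveTraces h ha)).1

/-- The factor `4` counts the positive elements into which `a` is decomposed. The bound makes `τ ↦ τ
1` definite on the cone and, with Banach-Alaoglu, its truncation compact. -/
theorem norm_apply_le_of_mem_positiveTraces {τ : WeakDual ℂ A} (h : τ ∈ positiveTraces A) (a : A) :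
    ‖τ a‖ ≤ 4 * ((τ 1).re * ‖a‖) := by
  obtain ⟨y, hy, hyn, hya⟩ := CStarAlgebra.exists_sum_four_nonneg a
  have key : ∀ b : A, 0 ≤ b → ‖τ b‖ ≤ (τ 1).re * ‖b‖ := by
    intro b hb
    have h1 := re_mono_of_mem_positiveTraces h (IsSelfAdjoint.of_nonneg hb).le_algebraMap_norm_self
    rw [Algebra.algebraMap_eq_smul_one, ← Complex.coe_smul, map_smul] at h1
    rw [← ofReal_re_apply_of_mem_positiveTraces h hb, Complex.norm_real,
      Real.norm_of_nonneg (re_nonneg_of_mem_positiveTraces h hb)]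
    simpa [mul_comm] using h1
  conv_lhs => rw [hya, map_sum]
  refine (norm_sum_le _ _).trans ((Finset.sum_le_sum
    (g := fun _ => (τ 1).re * ‖a‖) fun i _ => ?_).trans (by simp))
  rw [map_smul, norm_smul, norm_pow, Complex.norm_I, one_pow, one_mul]
  refine (key _ (hy i)).trans ?_
  exact mul_le_mul_of_nonneg_left (hyn i) (re_nonneg_of_mem_positiveTraces h zero_le_one)

/-- Take `y' = (x - z)⁺`, the least positive functional above `x - z`. Both `x` and `y` lie above `x
- z`, hence above `y'`. -/
theorem exists_riesz_decomposition_positiveTraces {x y z : WeakDual ℂ A}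
    (hx : x ∈ positiveTraces A) (hy : y ∈ positiveTraces A) (hz : z ∈ positiveTraces A)
    (hxyz : y + z - x ∈ positiveTraces A) :
    ∃ y' ∈ positiveTraces A, ∃ z' ∈ positiveTraces A, x = y' + z' ∧
      y - y' ∈ positiveTraces A ∧ z - z' ∈ positiveTraces A := by
  have happ : ∀ (τ φ : WeakDual ℂ A) (a : A), ((τ - φ) a).re = (τ a).re - (φ a).re :=
    fun _ _ _ => rfl
  have happ' : ∀ (τ φ : WeakDual ℂ A) (a : A), ((τ + φ) a).re = (τ a).re + (φ a).re :=
    fun _ _ _ => rfl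
  obtain ⟨ψ, hψ, hlub⟩ := exists_tracial_posPart (x - z) (fun a b => by
    have happ : ∀ a : A, (x - z) a = x a - z a := fun _ => rfl
    rw [happ, happ, hx.2, hz.2])
  have hxyz' := (sub_mem_positiveTraces_iff (add_mem_positiveTraces hy hz) hx).1 hxyz
  have hz' : x - ψ ∈ positiveTraces A := by
    refine (sub_mem_positiveTraces_iff hx hψ).2 fun a ha => (hlub a ha).2 ?_
    rintro _ ⟨b, ⟨hb, hba⟩, rfl⟩
    have h1 := re_mono_of_mem_positiveTraces hx hba
    have h2 := re_nonneg_of_mem_positiveTraces hz hb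
    simp only [happ]
    linarith
  refine ⟨ψ, hψ, x - ψ, hz', by abel, ?_, ?_⟩
  · refine (sub_mem_positiveTraces_iff hy hψ).2 fun a ha => (hlub a ha).2 ?_
    rintro _ ⟨b, ⟨hb, hba⟩, rfl⟩
    have h1 := re_mono_of_mem_positiveTraces hy hba
    have h2 := hxyz' b hb
    simp only [happ, happ'] at h2 ⊢
    linarith
  · refine (sub_mem_positiveTraces_iff hz hz').2 fun a ha => ?_
    have := (hlub a ha).1 ⟨a, ⟨ha, le_rfl⟩, rfl⟩
    simp only [happ] at this ⊢
    linarith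

theorem isRieszCone_positiveTraces : IsRieszCone (positiveTraces A) (reEval (1 : A)) where
  add_mem _ hx _ hy := add_mem_positiveTraces hx hy
  smul_mem := by
    rintro c hc x hx
    have happ : ∀ a : A, (c • x) a = c • x a := fun _ => rfl
    refine ⟨fun a => ?_, fun a b => ?_⟩
    · rw [happ]; exact smul_nonneg hc (hx.1 a)
    · rw [happ, happ, hx.2]
  isClosed := isClosed_positiveTraces
  nonneg x hx := re_nonneg_of_mem_positiveTraces hx zero_le_one
  eq_zero := by
    intro x hx h0
    rw [reEval_apply] at h0
    refine DFunLike.ext _ _ fun a => ?_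
    have := norm_apply_le_of_mem_positiveTraces hx a
    rw [h0, zero_mul, mul_zero] at this
    exact norm_le_zero_iff.1 this
  isCompact := by
    refine (WeakDual.isCompact_closedBall (𝕜 := ℂ) (0 : StrongDual ℂ A) 4).of_isClosed_subset
      (isClosed_positiveTraces.inter (isClosed_le (reEval (1 : A)).continuous continuous_const)) ?_
    rintro x ⟨hx, hx1⟩
    rw [reEval_apply] at hx1
    rw [Set.mem_preimage, mem_closedBall_zero_iff]
    refine ContinuousLinearMap.opNorm_le_bound _ (by norm_num) fun a => ?_
    refine (norm_apply_le_of_mem_positiveTraces hx a).trans ?_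
    gcongr
    exact mul_le_of_le_one_left (norm_nonneg a) hx1
  riesz _ hx _ hy _ hz hxyz := exists_riesz_decomposition_positiveTraces hx hy hz hxyz

theorem traceSpace_eq_base :
    traceSpace A = {τ ∈ positiveTraces A | reEval (1 : A) τ = 1} := by
  ext τ
  rw [mem_traceSpace_iff]
  refine and_congr_right fun h => ?_
  rw [reEval_apply, ← ofReal_re_apply_of_mem_positiveTraces h zero_le_one]
  norm_cast

/-- Traces in the closed convex hulls of disjoint compact sets of extreme traces are separated by
positive contractions. -/
theorem exists_lt_re_sub_of_mem_closedConvexHull {C D : Set (WeakDual ℂ A)} (hCc : IsCompact C)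
    (hC : C ⊆ extremeTraces A) (hDc : IsCompact D) (hD : D ⊆ extremeTraces A)
    (hCD : Disjoint C D) {σ ρ : WeakDual ℂ A} (hσ : σ ∈ closedConvexHull ℝ C)
    (hρ : ρ ∈ closedConvexHull ℝ D) {c : ℝ} (hc : c < 1) :
    ∃ a ∈ Set.Icc (0 : A) 1, c < (σ a).re - (ρ a).re := by
  have hR := isRieszCone_positiveTraces (A := A)
  rw [extremeTraces, traceSpace_eq_base] at hC hD
  obtain ⟨hσP, hσ1⟩ := hR.closedConvexHull_subset hC hσ
  obtain ⟨hρP, hρ1⟩ := hR.closedConvexHull_subset hD hρ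
  have happ : ∀ (τ φ : WeakDual ℂ A) (a : A), ((τ - φ) a).re = (τ a).re - (φ a).re :=
    fun _ _ _ => rfl
  obtain ⟨ψ, hψ, hlub⟩ := exists_tracial_posPart (σ - ρ) (fun a b => by
    have happ : ∀ a : A, (σ - ρ) a = σ a - ρ a := fun _ => rfl
    rw [happ, happ, hσP.2, hρP.2])
  have hz : σ - ψ ∈ positiveTraces A := by
    refine (sub_mem_positiveTraces_iff hσP hψ).2 fun a ha => (hlub a ha).2 ?_
    rintro _ ⟨b, ⟨hb, hba⟩, rfl⟩
    have h1 := re_mono_of_mem_positiveTraces hσP hba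
    have h2 := re_nonneg_of_mem_positiveTraces hρP hb
    simp only [happ]
    linarith
  -- `σ - ψ` is a common minorant of `σ` and `ρ`, so it vanishes and `ψ = σ`.
  have hz0 := hR.eq_zero_of_le_closedConvexHull hCc hC hDc hD hCD hσ hρ hz
    (by rwa [sub_sub_cancel]) <| by
      refine (sub_mem_positiveTraces_iff hρP hz).2 fun a ha => ?_
      have := (hlub a ha).1 ⟨a, ⟨ha, le_rfl⟩, rfl⟩
      simp only [happ] at this ⊢
      linarith
  have h1 := hlub 1 zero_le_one
  rw [← sub_eq_zero.1 hz0, show (σ 1).re = 1 from hσ1] at h1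
  obtain ⟨_, ⟨a, ha, rfl⟩, hca, -⟩ := h1.exists_between hc
  exact ⟨a, ha, hca⟩

/-- Minimax needs convex sets, so it is applied to the closed hulls of `C` and `D`, against the
convex set of positive contractions. -/
theorem exists_uniform_lt_re_sub {C D : Set (WeakDual ℂ A)} (hCc : IsCompact C)
    (hC : C ⊆ extremeTraces A) (hDc : IsCompact D) (hD : D ⊆ extremeTraces A)
    (hCD : Disjoint C D) (hCne : C.Nonempty) (hDne : D.Nonempty) {c : ℝ} (hc : c < 1) :
    ∃ a ∈ Set.Icc (0 : A) 1, ∀ σ ∈ C, ∀ ρ ∈ D, c < (σ a).re - (ρ a).re := by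
  have hR := isRieszCone_positiveTraces (A := A)
  have hC' := hC
  have hD' := hD
  rw [extremeTraces, traceSpace_eq_base] at hC' hD'
  obtain ⟨c', hcc', hc'⟩ := exists_between hc
  obtain ⟨a, ha, h⟩ := exists_forall_lt_sub_of_forall_exists_le (reEval (A := A))
    (fun φ => Complex.continuous_re.comp (map_continuous φ))
    (fun φ => ⟨fun a b => by simp [reEval_apply], fun s a => by
      simp only [reEval_apply]
      rw [← Complex.coe_smul, map_smul]
      simp⟩)
    (hCne.mono subset_closedConvexHull) convex_closedConvexHull
    (hR.isCompact_closedConvexHull hC') (hDne.mono subset_closedConvexHull)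
    convex_closedConvexHull (hR.isCompact_closedConvexHull hD') (convex_Icc (0 : A) 1) hcc'
    (fun σ hσ ρ hρ => by
      obtain ⟨a, ha, hca⟩ :=
        exists_lt_re_sub_of_mem_closedConvexHull hCc hC hDc hD hCD hσ hρ hc'
      exact ⟨a, ha, hca.le⟩)
  exact ⟨a, ha, fun σ hσ ρ hρ =>
    h σ (subset_closedConvexHull hσ) ρ (subset_closedConvexHull hρ)⟩

theorem re_mem_Icc_of_mem_extremeTraces {τ : WeakDual ℂ A} (hτ : τ ∈ extremeTraces A) {a : A}
    (ha : a ∈ Set.Icc (0 : A) 1) : (τ a).re ∈ Set.Icc (0 : ℝ) 1 := by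
  obtain ⟨hP, h1⟩ := mem_traceSpace_iff.1 hτ.1
  have := re_mono_of_mem_positiveTraces hP ha.2
  rw [h1] at this
  exact ⟨re_nonneg_of_mem_positiveTraces hP ha.1, by simpa using this⟩

/-- Noncommutative Urysohn lemma for the extreme boundary of the trace space. -/
theorem exists_urysohn_extremeTraces {C D : Set (WeakDual ℂ A)} (hCc : IsCompact C)
    (hC : C ⊆ extremeTraces A) (hDc : IsCompact D) (hD : D ⊆ extremeTraces A)
    (hCD : Disjoint C D) {ε : ℝ} (hε : 0 < ε) :
    ∃ a ∈ Set.Icc (0 : A) 1, (∀ σ ∈ C, 1 - ε < (σ a).re) ∧ ∀ ρ ∈ D, (ρ a).re < ε := by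
  rcases C.eq_empty_or_nonempty with rfl | hCne
  · exact ⟨0, ⟨le_rfl, zero_le_one⟩, by simp, fun ρ _ => by simpa using hε⟩
  rcases D.eq_empty_or_nonempty with rfl | hDne
  · refine ⟨1, ⟨zero_le_one, le_rfl⟩, fun σ hσ => ?_, by simp⟩
    rw [(hC hσ).1.2.1]
    simpa using hε
  obtain ⟨a, ha, h⟩ := exists_uniform_lt_re_sub hCc hC hDc hD hCD hCne hDne
    (sub_lt_self 1 hε)
  -- All values lie in `[0, 1]`, so a difference above `1 - ε` forces the larger above `1 - ε` and
  -- the smaller below `ε`.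
  obtain ⟨σ₀, hσ₀⟩ := hCne
  obtain ⟨ρ₀, hρ₀⟩ := hDne
  refine ⟨a, ha, fun σ hσ => ?_, fun ρ hρ => ?_⟩
  · have := h σ hσ ρ₀ hρ₀
    have := (re_mem_Icc_of_mem_extremeTraces (hD hρ₀) ha).1
    linarith
  · have := h σ₀ hσ₀ ρ hρ
    have := (re_mem_Icc_of_mem_extremeTraces (hC hσ₀) ha).2
    linarith

end TraceBoundary

/-! ### Layered approximation and conclusion -/

/-- At most one index has `k < t < k + 1`; it costs at most `1`, and every other index at most `ε`.
-/
theorem abs_sum_range_sub_le {N : ℕ} {x : ℕ → ℝ} {t ε : ℝ} (ht0 : 0 ≤ t) (htN : t ≤ N)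
    (hε : 0 ≤ ε) (hx : ∀ k < N, x k ∈ Set.Icc (0 : ℝ) 1)
    (hlow : ∀ k < N, (k : ℝ) + 1 ≤ t → 1 - ε ≤ x k) (hupp : ∀ k < N, t ≤ k → x k ≤ ε) :
    |∑ k ∈ Finset.range N, x k - t| ≤ 1 + N * ε := by
  rw [abs_le]
  constructor
  · have hj : ⌊t⌋₊ ≤ N := Nat.floor_le_of_le htN
    have h1 : (⌊t⌋₊ : ℝ) * (1 - ε) ≤ ∑ k ∈ Finset.range ⌊t⌋₊, x k := by
      have := Finset.card_nsmul_le_sum (Finset.range ⌊t⌋₊) x (1 - ε) fun k hk => by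
        have hk := Finset.mem_range.1 hk
        refine hlow k (hk.trans_le hj) ?_
        exact_mod_cast (Nat.le_floor_iff ht0).1 (Nat.succ_le_of_lt hk)
      simpa using this
    have h2 : ∑ k ∈ Finset.range ⌊t⌋₊, x k ≤ ∑ k ∈ Finset.range N, x k :=
      Finset.sum_le_sum_of_subset_of_nonneg (Finset.range_subset_range.2 hj)
        fun k hk _ => (hx k (Finset.mem_range.1 hk)).1
    have h3 := Nat.lt_floor_add_one t
    have h4 : (⌊t⌋₊ : ℝ) * ε ≤ N * ε := by gcongr
    linarith
  · have hj : ⌈t⌉₊ ≤ N := Nat.ceil_le.2 htN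
    rw [← Finset.sum_range_add_sum_Ico x hj]
    have h1 : ∑ k ∈ Finset.range ⌈t⌉₊, x k ≤ ⌈t⌉₊ := by
      have := Finset.sum_le_card_nsmul (Finset.range ⌈t⌉₊) x 1 fun k hk =>
        (hx k ((Finset.mem_range.1 hk).trans_le hj)).2
      simpa using this
    have h2 : ∑ k ∈ Finset.Ico ⌈t⌉₊ N, x k ≤ N * ε := by
      have := Finset.sum_le_card_nsmul (Finset.Ico ⌈t⌉₊ N) x ε fun k hk =>
        hupp k (Finset.mem_Ico.1 hk).2 (Nat.ceil_le.1 (Finset.mem_Ico.1 hk).1)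
      refine this.trans ?_
      rw [nsmul_eq_mul, Nat.card_Ico]
      gcongr
      exact Nat.sub_le _ _
    have h3 := Nat.ceil_lt_add_one ht0
    linarith

section Approximation

variable {A : Type*} [CStarAlgebra A] [PartialOrder A] [StarOrderedRing A]

theorem exists_nonneg_abs_re_sub_le [CompactSpace (extremeTraces A)]
    (f : C(extremeTraces A, ℝ)) (hf : 0 ≤ f) {N : ℕ} (hN : 0 < N) :
    ∃ a : A, 0 ≤ a ∧ ‖a‖ ≤ ‖f‖ ∧
      ∀ τ : extremeTraces A, |((τ : WeakDual ℂ A) a).re - f τ| ≤ 2 * ‖f‖ / N := by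
  -- For `f = 0` the layers would have height zero and the level sets below would not be disjoint.
  rcases (norm_nonneg f).eq_or_lt with h0 | hM
  · refine ⟨0, le_rfl, by simp, fun τ => ?_⟩
    rw [norm_eq_zero.1 h0.symm]
    simp
  have hN' : (0 : ℝ) < N := by exact_mod_cast hN
  set s := ‖f‖ / N with hs
  have hs0 : 0 < s := div_pos hM hN'
  have hcomp : ∀ S : Set (extremeTraces A), IsClosed S →
      IsCompact (Subtype.val '' S : Set (WeakDual ℂ A)) ∧
      (Subtype.val '' S : Set (WeakDual ℂ A)) ⊆ extremeTraces A := fun S hS =>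
    ⟨hS.isCompact.image continuous_subtype_val, Subtype.coe_image_subset _ _⟩
  -- Tolerance `1 / N` over `N` layers totals `1`; with the one uncontrolled layer the error is `2 *
  -- s`.
  have hsep : ∀ k : ℕ, ∃ a ∈ Set.Icc (0 : A) 1, ∀ τ : extremeTraces A,
      ((k + 1) * s ≤ f τ → 1 - 1 / N < ((τ : WeakDual ℂ A) a).re) ∧
      (f τ ≤ k * s → ((τ : WeakDual ℂ A) a).re < 1 / N) := by
    intro k
    obtain ⟨hC, hC'⟩ := hcomp {τ | (k + 1) * s ≤ f τ} (isClosed_le continuous_const f.continuous)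
    obtain ⟨hD, hD'⟩ := hcomp {τ | f τ ≤ k * s} (isClosed_le f.continuous continuous_const)
    obtain ⟨a, ha, h1, h2⟩ := exists_urysohn_extremeTraces hC hC' hD hD'
      ((Set.disjoint_image_iff Subtype.val_injective).2 (by
        rw [Set.disjoint_left]
        intro τ h1 h2
        have := le_trans (show (k + 1) * s ≤ f τ from h1) h2
        nlinarith)) (one_div_pos.2 hN')
    exact ⟨a, ha, fun τ => ⟨fun h => h1 τ ⟨τ, h, rfl⟩, fun h => h2 τ ⟨τ, h, rfl⟩⟩⟩
  choose a ha hτ using hsep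
  refine ⟨s • ∑ k ∈ Finset.range N, a k, ?_, ?_, fun τ => ?_⟩
  · exact smul_nonneg hs0.le (Finset.sum_nonneg fun k _ => (ha k).1)
  · rw [norm_smul, Real.norm_of_nonneg hs0.le]
    have : ‖∑ k ∈ Finset.range N, a k‖ ≤ N := by
      refine (norm_sum_le _ _).trans ((Finset.sum_le_card_nsmul _ _ 1 fun k _ =>
        (CStarAlgebra.norm_le_one_iff_of_nonneg _ (ha k).1).2 (ha k).2).trans (by simp))
    calc s * ‖∑ k ∈ Finset.range N, a k‖ ≤ s * N := by gcongr
      _ = ‖f‖ := by rw [hs]; field_simp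
  · have hfτ : f τ ≤ ‖f‖ := (le_abs_self _).trans (f.norm_coe_le_norm τ)
    have hx := abs_sum_range_sub_le (N := N) (x := fun k => ((τ : WeakDual ℂ A) (a k)).re)
      (t := f τ / s) (ε := 1 / N) (div_nonneg (hf τ) hs0.le)
      (by
        rw [div_le_iff₀ hs0, hs]
        calc f τ ≤ ‖f‖ := hfτ
          _ = N * (‖f‖ / N) := by field_simp)
      (by positivity) (fun k _ => re_mem_Icc_of_mem_extremeTraces τ.2 (ha k))
      (fun k _ hk => ((hτ k τ).1 ((le_div_iff₀ hs0).1 hk)).le)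
      (fun k _ hk => ((hτ k τ).2 ((div_le_iff₀ hs0).1 hk)).le)
    rw [mul_one_div_cancel hN'.ne'] at hx
    have h1 : ((τ : WeakDual ℂ A) (s • ∑ k ∈ Finset.range N, a k)).re
        = s * ∑ k ∈ Finset.range N, ((τ : WeakDual ℂ A) (a k)).re := by
      rw [← Complex.coe_smul, map_smul, map_sum, smul_eq_mul, Complex.re_ofReal_mul,
        Complex.re_sum]
    have h2 : f τ = s * (f τ / s) := by field_simp
    rw [h1]
    conv_lhs => rw [h2]
    rw [← mul_sub, abs_mul, abs_of_pos hs0]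
    calc _ ≤ s * (1 + 1) := by gcongr
      _ = 2 * ‖f‖ / N := by rw [hs]; ring

end Approximation

theorem proposition4p1 {A : Type*} [CStarAlgebra A] [PartialOrder A] [StarOrderedRing A]
    [TopologicalSpace.SeparableSpace A]
    (hsimple : IsSimpleCStarAlgebra A)
    (hinf : ¬ FiniteDimensional ℂ A)
    (htrace : (traceSpace A).Nonempty)
    [CompactSpace (extremeTraces A)]
    (f : C(extremeTraces A, ℝ)) (hf : 0 ≤ f) :
    ∃ a : ℕ → A, (∀ n, 0 ≤ a n) ∧ (∀ n, ‖a n‖ ≤ ‖f‖) ∧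
      TendstoUniformly (fun (n : ℕ) (τ : extremeTraces A) => (τ : WeakDual ℂ A) (a n))
        (fun τ => (f τ : ℂ)) atTop := by
  choose a ha hnorm hτ using fun n : ℕ => exists_nonneg_abs_re_sub_le f hf n.succ_pos
  refine ⟨a, ha, hnorm, Metric.tendstoUniformly_iff.2 fun ε hε => ?_⟩
  have hlim : Tendsto (fun n : ℕ => 2 * ‖f‖ / (n.succ : ℝ)) atTop (𝓝 0) :=
    (tendsto_const_div_atTop_nhds_zero_nat _).comp (tendsto_add_atTop_nat 1)
  filter_upwards [hlim.eventually (gt_mem_nhds hε)] with n hn τ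
  -- Traces of positive elements are real, so only real parts need comparing.
  rw [dist_comm, ← ofReal_re_apply_of_mem_positiveTraces (mem_traceSpace_iff.1 τ.2.1).1 (ha n),
    Complex.dist_of_im_eq (by simp)]
  simp only [Complex.ofReal_re, Real.dist_eq]
  exact (hτ n τ).trans_lt hn
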